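/- All rings and algebras are commutative. Let $n\ge 0$, let $G$ be a subgroup of the symmetric group $S_n$, let $R$ be a ring, and for an $R$-algebra $A$ let $(A^{\otimes n})^G$ be the subalgebra of the $n$-fold tensor power of $A$ over $R$ fixed by $G$ permuting the tensor factors. For $a\in A$ let $e_k(a)\in (A^{\otimes n})^G$ be the $k$-th elementary symmetric polynomial in the $n$ elements $a^{(i)}=1\otimes\cdots\otimes a\otimes\cdots\otimes 1$ ($a$ in position $i$). If $A$ is free of rank $n$ as an $R$-module, let $\lambda^n-s_1(a)\lambda^{n-1}+\cdots+(-1)^ns_n(a)$ be the characteristic polynomial of multiplication by $a$ on $A$; a $G$-closure datum for $A$ over $R$ is an $R$-algebra homomorphism $\phi:(A^{\otimes n})^G\to R$ with $\phi(e_k(b))=s_k(b)$ for all $b\in A$ and $1\le k\le n$. The pair $(R,G)$ is called benign if for every $R$-algebra $B$ with an action of $G$ by $R$-algebra automorphisms and every $R$-algebra homomorphism $B^G\to R$, the $R$-algebra $B\otimes_{B^G}R$ is faithful, i.e. $R\to B\otimes_{B^G}R$ is injective. Lemma. Let $A$ be a monogenic $R$-algebra of rank $n$ with generator $a$, that is,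 there is an isomorphism of $R$-algebras $A\cong R[x]/(f(x))$ with $f$ monic of degree $n$ under which $a$ corresponds to the class of $x$; let $\pi:(R[x]^{\otimes n})^G\to (A^{\otimes n})^G$ be the homomorphism induced by $x\mapsto a$. (1) If $R$ is reduced, or if $|G|$ is a non-zerodivisor in $R$, then $(R,G)$ is benign. (2) If $\phi$ is a $G$-closure datum for $A$ over $R$, then $\phi\circ\pi:(R[x]^{\otimes n})^G\to R$ is an $R$-algebra homomorphism sending $e_k(x)$ to $s_k(a)$ for all $1\le k\le n$. (3) If $(R,G)$ is benign, then $\phi\mapsto\phi\circ\pi$ is a bijection from the set of $G$-closure data for $A$ over $R$ to the set of $R$-algebra homomorphisms $(R[x]^{\otimes n})^G\to R$ that send $e_k(x)$ to $s_k(a)$ for all $1\le k\le n$. -/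

import Mathlib

open scoped TensorProduct Polynomial

universe u v w

namespace ClosureData

noncomputable section

/-- For an action `ρ` of a group `G` on an `R`-algebra `B` by `R`-algebra automorphisms, the
subalgebra `B^G` of invariants. -/
def invariants {R : Type u} {B : Type v} [CommRing R] [CommRing B] [Algebra R B]
    {G : Type w} [Group G] (ρ : G →* (B ≃ₐ[R] B)) : Subalgebra R B where
  carrier := {b | ∀ g : G, ρ g b = b}
  mul_mem' hx hy g := by rw [map_mul, hx g, hy g]
  add_mem' hx hy g := by rw [map_add, hx g, hy g]
  algebraMap_mem' r g := (ρ g).commutes r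

/-- The pair `(R, G)` is benign: for every `R`-algebra `B` on which `G` acts by `R`-algebra
automorphisms and every `R`-algebra homomorphism `ψ : B^G → R`, the `R`-algebra
`B ⊗_{B^G} R` (formed along `ψ`) is faithful, i.e. its structure map `r ↦ 1 ⊗ r` is injective. -/
def IsBenign (R : Type u) [CommRing R] {n : ℕ} (G : Subgroup (Equiv.Perm (Fin n))) : Prop :=
  ∀ (B : Type u) [CommRing B] [Algebra R B] (ρ : G →* (B ≃ₐ[R] B))
    (ψ : invariants ρ →ₐ[R] R),
    letI : Algebra (invariants ρ) R := ψ.toRingHom.toAlgebra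
    Function.Injective
      (Algebra.TensorProduct.includeRight : R →ₐ[invariants ρ] B ⊗[invariants ρ] R)

/-- The `n`-fold tensor power `A^{⊗n}` over `R`, with its usual `R`-algebra structure. -/
abbrev TPow (R : Type u) (A : Type v) [CommRing R] [CommRing A] [Algebra R A] (n : ℕ) :
    Type (max u v) :=
  ⨂[R] _ : Fin n, A

section TensorPower

variable (R : Type u) (A : Type v) [CommRing R] [CommRing A] [Algebra R A] (n : ℕ)

/-- The permutation of tensor factors; it moves the factor in position `i` to position `σ i`. -/
def permHom (σ : Equiv.Perm (Fin n)) : TPow R A n →ₐ[R] TPow R A n :=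
  AlgHom.ofLinearMap (PiTensorProduct.reindex R (fun _ : Fin n => A) σ).toLinearMap
    (by
      rw [PiTensorProduct.one_def]
      exact PiTensorProduct.reindex_tprod (R := R) (s := fun _ : Fin n => A) σ 1)
    (by
      intro x y
      induction x using PiTensorProduct.induction_on with
      | add x₁ x₂ h₁ h₂ => simp only [add_mul, map_add, h₁, h₂]
      | smul_tprod r f =>
        induction y using PiTensorProduct.induction_on with
        | add y₁ y₂ h₁ h₂ => simp only [mul_add, map_add, h₁, h₂]
        | smul_tprod s g =>
          simp only [smul_mul_smul_comm, map_smul, PiTensorProduct.tprod_mul_tprod,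
            LinearEquiv.coe_coe, PiTensorProduct.reindex_tprod]
          rfl)

lemma permHom_tprod (σ : Equiv.Perm (Fin n)) (f : Fin n → A) :
    permHom R A n σ (PiTensorProduct.tprod R f) =
      PiTensorProduct.tprod R (fun i => f (σ.symm i)) :=
  PiTensorProduct.reindex_tprod (R := R) (s := fun _ : Fin n => A) σ f

lemma permHom_one : permHom R A n 1 = AlgHom.id R (TPow R A n) := by
  refine AlgHom.toLinearMap_injective (PiTensorProduct.ext (MultilinearMap.ext fun f => ?_))
  exact permHom_tprod R A n 1 f

lemma permHom_mul (σ τ : Equiv.Perm (Fin n)) :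
    permHom R A n (σ * τ) = (permHom R A n σ).comp (permHom R A n τ) := by
  refine AlgHom.toLinearMap_injective (PiTensorProduct.ext (MultilinearMap.ext fun f => ?_))
  refine (permHom_tprod R A n (σ * τ) f).trans ?_
  refine Eq.symm ((congrArg (permHom R A n σ) (permHom_tprod R A n τ f)).trans ?_)
  exact permHom_tprod R A n σ _

/-- The action of the symmetric group on `A^{⊗n}` by permuting the tensor factors. -/
def permAction : Equiv.Perm (Fin n) →* (TPow R A n ≃ₐ[R] TPow R A n) where
  toFun σ := AlgEquiv.ofAlgHom (permHom R A n σ) (permHom R A n σ⁻¹)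
    (by rw [← permHom_mul, mul_inv_cancel, permHom_one])
    (by rw [← permHom_mul, inv_mul_cancel, permHom_one])
  map_one' := AlgEquiv.ext fun x => DFunLike.congr_fun (permHom_one R A n) x
  map_mul' σ τ := AlgEquiv.ext fun x => DFunLike.congr_fun (permHom_mul R A n σ τ) x

/-- The subalgebra `(A^{⊗n})^G` of invariants under a permutation group `G`. -/
abbrev fixPower (G : Subgroup (Equiv.Perm (Fin n))) : Subalgebra R (TPow R A n) :=
  invariants ((permAction R A n).comp G.subtype)

variable {A}

/-- `1 ⊗ ⋯ ⊗ a ⊗ ⋯ ⊗ 1`, with `a` in position `i`. -/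
def conjugate (a : A) (i : Fin n) : TPow R A n :=
  PiTensorProduct.tprod R (Pi.mulSingle i a)

lemma permAction_conjugate (σ : Equiv.Perm (Fin n)) (a : A) (i : Fin n) :
    permAction R A n σ (conjugate R n a i) = conjugate R n a (σ i) := by
  refine (permHom_tprod R A n σ _).trans ?_
  unfold conjugate
  congr 1
  ext j
  by_cases h : j = σ i
  · subst h; simp
  · have h' : σ.symm j ≠ i := fun e => h (by rw [← e]; simp)
    simp [Pi.mulSingle_eq_of_ne h, Pi.mulSingle_eq_of_ne h']

/-- The `k`-th elementary symmetric polynomial in the conjugates `a⁽¹⁾, …, a⁽ⁿ⁾`, in `A^{⊗n}`. -/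
def elemSymm (k : ℕ) (a : A) : TPow R A n :=
  ∑ s ∈ Finset.powersetCard k (Finset.univ : Finset (Fin n)), ∏ i ∈ s, conjugate R n a i

lemma elemSymm_mem (G : Subgroup (Equiv.Perm (Fin n))) (k : ℕ) (a : A) :
    elemSymm R n k a ∈ fixPower R A n G := by
  intro σ
  have h : elemSymm R n k a =
      MvPolynomial.aeval (conjugate R n a) (MvPolynomial.esymm (Fin n) R k) := by
    simp [elemSymm, MvPolynomial.esymm]
  change permAction R A n (σ : Equiv.Perm (Fin n)) _ = _
  rw [h]
  conv_rhs => rw [← MvPolynomial.esymm_isSymmetric (Fin n) R k (σ : Equiv.Perm (Fin n)),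
    MvPolynomial.aeval_rename]
  have := MvPolynomial.comp_aeval_apply (R := R) (f := conjugate R n a)
    (permAction R A n (σ : Equiv.Perm (Fin n)) : TPow R A n →ₐ[R] TPow R A n)
    (MvPolynomial.esymm (Fin n) R k)
  refine this.trans ?_
  congr 2
  ext i
  exact permAction_conjugate R n _ a i

/-- `e_k(a)` as an element of `(A^{⊗n})^G`. -/
def e (G : Subgroup (Equiv.Perm (Fin n))) (k : ℕ) (a : A) : fixPower R A n G :=
  ⟨elemSymm R n k a, elemSymm_mem R n G k a⟩

/-- `s_k(a)`: the characteristic polynomial of multiplication by `a` on the algebra `A`, free of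
rank `n`, is `λⁿ - s_1(a) λⁿ⁻¹ + ⋯ + (-1)ⁿ s_n(a)`. Used for `1 ≤ k ≤ n`. -/
def s [Module.Free R A] [Module.Finite R A] (k : ℕ) (a : A) : R :=
  (-1) ^ k * (LinearMap.charpoly (Algebra.lmul R A a)).coeff (n - k)

/-- An `R`-algebra homomorphism `φ : (A^{⊗n})^G → R` is a `G`-closure datum for the rank-`n`
algebra `A` if it sends `e_k(a)` to `s_k(a)` for all `a ∈ A` and `1 ≤ k ≤ n`. -/
def IsClosureDatum [Module.Free R A] [Module.Finite R A] (G : Subgroup (Equiv.Perm (Fin n)))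
    (φ : fixPower R A n G →ₐ[R] R) : Prop :=
  ∀ (a : A) (k : ℕ), 1 ≤ k → k ≤ n → φ (e R n G k a) = s R n k a

/-- `A` is a monogenic `R`-algebra of rank `n` with generator `a`: there is an isomorphism
`R[x]/(f) ≅ A` sending the class of `x` to `a`, for some monic `f` of degree `n`
(i.e. `f = xⁿ + lower terms`; in this form also meaningful over the zero ring). -/
def IsMonogenic (a : A) : Prop :=
  ∃ f : R[X], f.natDegree ≤ n ∧ f.coeff n = 1 ∧
    ∃ ι : AdjoinRoot f ≃ₐ[R] A, ι (AdjoinRoot.root f) = a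

variable {R} {A' : Type w} [CommRing A'] [Algebra R A']

/-- The `n`-th tensor power of an algebra homomorphism. -/
def tpowMap (f : A →ₐ[R] A') : TPow R A n →ₐ[R] TPow R A' n :=
  AlgHom.ofLinearMap (PiTensorProduct.map (fun _ : Fin n => f.toLinearMap))
    (by
      rw [PiTensorProduct.one_def, PiTensorProduct.map_tprod, PiTensorProduct.one_def]
      congr 1
      ext i
      simp)
    (by
      intro x y
      induction x using PiTensorProduct.induction_on with
      | add x₁ x₂ h₁ h₂ => simp only [add_mul, map_add, h₁, h₂]
      | smul_tprod r g =>
        induction y using PiTensorProduct.induction_on with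
        | add y₁ y₂ h₁ h₂ => simp only [mul_add, map_add, h₁, h₂]
        | smul_tprod r' g' =>
          simp only [smul_mul_smul_comm, map_smul, PiTensorProduct.tprod_mul_tprod,
            PiTensorProduct.map_tprod]
          congr 2
          ext i
          simp)

lemma tpowMap_perm (f : A →ₐ[R] A') (σ : Equiv.Perm (Fin n)) (x : TPow R A n) :
    tpowMap n f (permAction R A n σ x) = permAction R A' n σ (tpowMap n f x) := by
  have h : (tpowMap n f).toLinearMap ∘ₗ (permHom R A n σ).toLinearMap =
      (permHom R A' n σ).toLinearMap ∘ₗ (tpowMap n f).toLinearMap := by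
    ext g
    have h1 : ∀ g : Fin n → A, tpowMap n f (PiTensorProduct.tprod R g) =
        PiTensorProduct.tprod R (fun i => f (g i)) := fun g => PiTensorProduct.map_tprod _ g
    simp [permHom_tprod, h1]
  exact LinearMap.congr_fun h x

/-- The homomorphism `(A^{⊗n})^G → (A'^{⊗n})^G` induced by `f : A → A'`. -/
def fixMap (G : Subgroup (Equiv.Perm (Fin n))) (f : A →ₐ[R] A') :
    fixPower R A n G →ₐ[R] fixPower R A' n G :=
  ((tpowMap n f).comp (fixPower R A n G).val).codRestrict (fixPower R A' n G)
    (fun x σ => by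
      refine (tpowMap_perm n f (σ : Equiv.Perm (Fin n)) x.1).symm.trans ?_
      exact congrArg (tpowMap n f) (x.2 σ))

end TensorPower

end

end ClosureData

/-!
For reduced `R`, benignness is lying over for the integral extension `B^G ⊆ B`: every prime of `R`,
pulled back to `B^G`, lies under a prime of `B`, so the kernel of `R → B ⊗_{B^G} R` is contained in
every prime (`isBenign_of_isReduced`). If `|G|` is a non-zero-divisor, the trace of `G` gives a map
`B ⊗_{B^G} R → R` which restricts to multiplication by `|G|` on `R`
(`isBenign_of_card_mem_nonZeroDivisors`).

The map `(R[X]^{⊗n})^G → (A^{⊗n})^G` is surjective, because a linear section of `R[X] → A` induces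
an equivariant section on tensor powers (`fixMap_surjective`); so composing with it is injective.
For the other direction, let `ψ : (R[X]^{⊗n})^G → R` send `e_k(X)` to `s_k(a)`. Benignness extends
`ψ` to a homomorphism `j` from `R[X]^{⊗n}` to a faithful `R`-algebra `T`. By Vieta, the
characteristic polynomial of `a` becomes `∏ (X - cᵢ)` over `T`, where `cᵢ = j(X⁽ⁱ⁾)`
(`IsMonogenic.charpoly_map_eq_prod`). Hence each `cᵢ` is the image of `a` under a homomorphism
`A → T`, so that `j` factors through `A^{⊗n}`; since `R → T` is injective, `ψ` kills the kernel of
the surjection and descends to some `φ`.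

That `φ(e_k(b)) = s_k(b)` for every `b = g(a)`, and not only for `b = a`, can be checked in `T`,
where it says that the characteristic polynomial of `g(a)` is `∏ (X - g(cᵢ))`. This is the spectral
mapping theorem over an arbitrary commutative ring (`charpoly_aeval_eq_prod`). It comes down to
`det h(M) = ∏ h(cᵢ)` for a matrix `M` with characteristic polynomial `∏ (X - cᵢ)`; there `h` may be
made monic by adding a multiple of that polynomial, then split into linear factors over a finite
free extension, and for linear factors the identity is the definition of the characteristic
polynomial.
-/

namespace ClosureData

/-! ### Characteristic polynomial of a polynomial in a matrix -/

section CharpolyAeval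

open Polynomial

variable {S : Type u} [CommRing S] {m ι : Type*} [Fintype m] [DecidableEq m] [Fintype ι]

lemma det_aeval_multiset_prod (M : Matrix m m S) (c : ι → S)
    (hM : M.charpoly = ∏ i, (X - C (c i))) (t : Multiset S) :
    (aeval M (t.map fun r => X - C r).prod).det =
      ∏ i, eval (c i) (t.map fun r => X - C r).prod := by
  have hcard : Nontrivial S → Fintype.card ι = Fintype.card m := fun _ => by
    have := congrArg natDegree hM
    rwa [Matrix.charpoly_natDegree_eq_dim, natDegree_prod_of_monic _ _
      (fun i _ => monic_X_sub_C _), Finset.sum_congr rfl (fun i _ => natDegree_X_sub_C _),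
      Finset.sum_const, smul_eq_mul, mul_one, Finset.card_univ, eq_comm] at this
  nontriviality S
  induction t using Multiset.induction_on with
  | empty => simp
  | cons r t ih =>
    rw [Multiset.map_cons, Multiset.prod_cons, map_mul, Matrix.det_mul, ih]
    simp only [eval_mul, Finset.prod_mul_distrib]
    congr 1
    have h := Matrix.eval_charpoly M r
    rw [hM, eval_prod] at h
    have h2 : aeval M (X - C r) = -(Matrix.scalar m r - M) := by
      simp [Matrix.algebraMap_eq_diagonal, Pi.algebraMap_def, Matrix.scalar_apply]
    rw [h2, Matrix.det_neg, ← h, ← hcard inferInstance, ← Finset.card_univ,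
      ← Finset.prod_const, ← Finset.prod_mul_distrib]
    refine Finset.prod_congr rfl fun i _ => ?_
    simp

/-- If the characteristic polynomial of `M` is `∏ (X - cᵢ)`, then `det h(M) = ∏ h(cᵢ)`, over an
arbitrary commutative ring. -/
lemma det_aeval_eq_prod_eval (M : Matrix m m S) (c : ι → S)
    (hM : M.charpoly = ∏ i, (X - C (c i))) (h : S[X]) :
    (aeval M h).det = ∏ i, eval (c i) h := by
  nontriviality S
  -- Adding a multiple of the characteristic polynomial changes neither side, so `h` may be
  -- taken to be monic.
  wlog hmon : h.Monic generalizing h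
  · have hroot : ∀ i, eval (c i) M.charpoly = 0 := fun i => by
      rw [hM, eval_prod]
      exact Finset.prod_eq_zero (Finset.mem_univ i) (by simp)
    have := this (h + X ^ (h.natDegree + 1) * M.charpoly)
      (((monic_X_pow _).mul M.charpoly_monic).add_of_right (by
        rw [M.charpoly_monic.degree_mul, degree_X_pow]
        refine (degree_le_natDegree).trans_lt ?_
        rw [degree_eq_natDegree M.charpoly_monic.ne_zero]
        norm_cast
        omega))
    simpa [hroot, Matrix.aeval_self_charpoly] using this
  -- A monic polynomial splits over some finite free, hence faithful, extension.
  obtain ⟨T, _, _, _, _, _, hT⟩ := hmon.exists_splits_map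
  have hinj : Function.Injective (algebraMap S T) := FaithfulSMul.algebraMap_injective S T
  obtain ⟨t, ht⟩ : ∃ t : Multiset T, h.map (algebraMap S T) = (t.map fun r => X - C r).prod := by
    obtain ⟨t, ht⟩ := splits_iff_exists_multiset.1 hT
    refine ⟨t, ?_⟩
    rwa [(hmon.map _).leadingCoeff, C_1, one_mul] at ht
  have key := det_aeval_multiset_prod (M.map (algebraMap S T)) (fun i => algebraMap S T (c i))
    (by rw [Matrix.charpoly_map, hM, Polynomial.map_prod]; simp) t
  rw [← ht] at key
  apply hinj
  rw [map_prod, RingHom.map_det]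
  convert key using 2
  · rw [aeval_map_algebraMap]
    exact (aeval_algHom_apply ((Algebra.ofId S T).mapMatrix) M h).symm
  · rw [eval_map, eval₂_at_apply]

/-- Spectral mapping over an arbitrary commutative ring: if the characteristic polynomial of `M` is
`∏ (X - cᵢ)`, then that of `g(M)` is `∏ (X - g(cᵢ))`. -/
lemma charpoly_aeval_eq_prod (M : Matrix m m S) (c : ι → S)
    (hM : M.charpoly = ∏ i, (X - C (c i))) (g : S[X]) :
    (aeval M g).charpoly = ∏ i, (X - C (eval (c i) g)) := by
  have key := det_aeval_eq_prod_eval (M.map (C : S →+* S[X])) (fun i => C (c i))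
    (by rw [Matrix.charpoly_map, hM, Polynomial.map_prod]; simp) (C X - g.map C)
  simp only [eval_sub, eval_C, eval_map, eval₂_at_apply] at key
  rw [← key, Matrix.charpoly, Matrix.charmatrix, map_sub, aeval_C,
    Matrix.algebraMap_eq_diagonal]
  congr 2
  rw [← algebraMap_eq, aeval_map_algebraMap]
  exact (aeval_algHom_apply ((Algebra.ofId S S[X]).mapMatrix) M g).symm

end CharpolyAeval

/-! ### Benign pairs -/

section Benign

variable {R : Type u} [CommRing R] {n : ℕ} {G : Subgroup (Equiv.Perm (Fin n))}

/-- If `R` is reduced then `(R, G)` is benign: as `B` is integral over `B^G`, every prime of `R`,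
seen as a prime of `B^G` through `ψ`, lies under a prime of `B`, so the kernel of
`R → B ⊗_{B^G} R` is contained in every prime of `R`. -/
theorem isBenign_of_isReduced (hR : IsReduced R) : IsBenign R G := by
  intro B _ _ ρ ψ
  let _ : Algebra (invariants ρ) R := ψ.toRingHom.toAlgebra
  rw [injective_iff_map_eq_zero]
  intro r hr
  let _ : MulSemiringAction G B :=
    { smul g b := ρ g b
      one_smul b := by change ρ 1 b = b; simp
      mul_smul g h b := by change ρ (g * h) b = ρ g (ρ h b); simp
      smul_zero g := map_zero (ρ g)
      smul_add g := map_add (ρ g)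
      smul_one g := map_one (ρ g)
      smul_mul g := map_mul (ρ g) }
  have : Algebra.IsInvariant (invariants ρ) B G := ⟨fun b hb => ⟨⟨b, hb⟩, rfl⟩⟩
  have := Algebra.IsInvariant.isIntegral (invariants ρ) B G
  refine (nilpotent_iff_mem_prime.2 fun p hp => ?_ : IsNilpotent r).eq_zero
  obtain ⟨Q, -, -, hQ⟩ := Ideal.exists_ideal_over_prime_of_isIntegral
    (p.comap ψ.toRingHom) (⊥ : Ideal B) (by
      intro x hx
      have : x = 0 := Subtype.ext hx
      rw [this]
      exact Ideal.zero_mem _)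
  have hmem : ∀ x : invariants ρ, (x : B) ∈ Q ↔ ψ x ∈ p := fun x => by
    change x ∈ Q.comap (algebraMap (invariants ρ) B) ↔ _
    rw [hQ]
    rfl
  -- The ring `B / Q` receives compatible maps from `B` and from `R`.
  let θ : R →ₐ[invariants ρ] B ⧸ Q :=
    { (Ideal.Quotient.mk Q).comp (algebraMap R B) with
      commutes' := fun x => by
        change Ideal.Quotient.mk Q (algebraMap R B (ψ x)) = Ideal.Quotient.mk Q (x : B)
        rw [Ideal.Quotient.eq]
        refine (hmem (algebraMap R (invariants ρ) (ψ x) - x)).2 ?_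
        simp }
  have h0 := congrArg
    (Algebra.TensorProduct.productMap (Ideal.Quotient.mkₐ (invariants ρ) Q) θ) hr
  have h1 : Ideal.Quotient.mk Q (algebraMap R B r) = 0 := by
    rw [map_zero] at h0
    exact (Algebra.TensorProduct.productMap_right_apply _ θ r).symm.trans h0
  rw [Ideal.Quotient.eq_zero_iff_mem] at h1
  simpa using (hmem (algebraMap R (invariants ρ) r)).1 h1

/-- If `|G|` is a non-zero-divisor in `R` then `(R, G)` is benign: the trace `B → B^G` induces a map
`B ⊗_{B^G} R → R` whose composite with `R → B ⊗_{B^G} R` is multiplication by `|G|`. -/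
theorem isBenign_of_card_mem_nonZeroDivisors (hG : (Nat.card G : R) ∈ nonZeroDivisors R) :
    IsBenign R G := by
  classical
  intro B _ _ ρ ψ
  let _ : Algebra (invariants ρ) R := ψ.toRingHom.toAlgebra
  rw [injective_iff_map_eq_zero]
  intro r hr
  have hr : (1 : B) ⊗ₜ[invariants ρ] r = 0 := hr
  let tr : B →ₗ[invariants ρ] invariants ρ :=
    { toFun b := ⟨∑ g : G, ρ g b, fun h => by
        rw [map_sum]
        refine Fintype.sum_equiv (Equiv.mulLeft h) _ _ fun g => ?_
        simp⟩
      map_add' x y := Subtype.ext (by simp [Finset.sum_add_distrib])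
      map_smul' s x := Subtype.ext (by
        change ∑ g : G, ρ g ((s : B) * x) = (s : B) * ∑ g : G, ρ g x
        rw [Finset.mul_sum]
        exact Finset.sum_congr rfl fun g _ => by rw [map_mul, s.2 g]) }
  let Θ : B ⊗[invariants ρ] R →ₗ[invariants ρ] R :=
    TensorProduct.lift ((LinearMap.mul (invariants ρ) R).comp
      ((Algebra.linearMap (invariants ρ) R).comp tr))
  have h0 := congrArg Θ hr
  rw [map_zero] at h0
  have h1 : ψ (tr 1) * r = 0 := h0
  have h2 : tr 1 = (Nat.card G : invariants ρ) := Subtype.ext (by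
    change ∑ g : G, ρ g 1 = _
    simp)
  rw [h2, map_natCast, mul_comm] at h1
  exact (mem_nonZeroDivisors_iff_right.1 hG) r h1

/-- Benignness in usable form: `ψ : B^G → R` extends to a homomorphism from `B` to a faithful
`R`-algebra. -/
lemma IsBenign.exists_extension (h : IsBenign R G) (B : Type u) [CommRing B] [Algebra R B]
    (ρ : G →* (B ≃ₐ[R] B)) (ψ : invariants ρ →ₐ[R] R) :
    ∃ (T : Type u) (_ : CommRing T) (_ : Algebra R T) (j : B →ₐ[R] T),
      Function.Injective (algebraMap R T) ∧
        ∀ x : invariants ρ, j x = algebraMap R T (ψ x) := by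
  let _ : Algebra (invariants ρ) R := ψ.toRingHom.toAlgebra
  let right : R →ₐ[invariants ρ] B ⊗[invariants ρ] R := Algebra.TensorProduct.includeRight
  let left : B →ₐ[invariants ρ] B ⊗[invariants ρ] R := Algebra.TensorProduct.includeLeft
  let _ : Algebra R (B ⊗[invariants ρ] R) := right.toRingHom.toAlgebra
  have hleft : ∀ x : invariants ρ, left x = right (ψ x) := fun x =>
    (left.commutes x).trans (right.commutes x).symm
  refine ⟨B ⊗[invariants ρ] R, inferInstance, ‹_›,
    { left with
      commutes' := fun r => ?_ }, h B ρ ψ, hleft⟩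
  have := hleft (algebraMap R _ r)
  rwa [AlgHom.commutes] at this

end Benign

/-! ### Tensor powers -/

section TensorPower

variable {R : Type u} [CommRing R] {n : ℕ} {G : Subgroup (Equiv.Perm (Fin n))}

lemma conjugate_eq_singleAlgHom {A : Type v} [CommRing A] [Algebra R A] (a : A) (i : Fin n) :
    conjugate R n a i = PiTensorProduct.singleAlgHom (R := R) (A := fun _ => A) i a :=
  rfl

lemma tpowMap_conjugate {A : Type v} {A' : Type w} [CommRing A] [CommRing A'] [Algebra R A]
    [Algebra R A'] (f : A →ₐ[R] A') (a : A) (i : Fin n) :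
    tpowMap n f (conjugate R n a i) = conjugate R n (f a) i := by
  refine (PiTensorProduct.map_tprod _ _).trans (congrArg _ (funext fun j => ?_))
  exact Pi.apply_mulSingle (fun _ => f) (fun _ => map_one f) i a j

lemma fixMap_e {A : Type v} {A' : Type w} [CommRing A] [CommRing A'] [Algebra R A]
    [Algebra R A'] (f : A →ₐ[R] A') (k : ℕ) (a : A) :
    fixMap n G f (e R n G k a) = e R n G k (f a) := by
  refine Subtype.ext ?_
  change tpowMap n f (elemSymm R n k a) = elemSymm R n k (f a)
  simp [elemSymm, tpowMap_conjugate]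

/-- A linear section of `f` induces a `G`-equivariant linear section of its tensor power, so `f`
induces a surjection on invariants. -/
lemma fixMap_surjective {A : Type v} {A' : Type w} [CommRing A] [CommRing A'] [Algebra R A]
    [Algebra R A'] [Module.Projective R A'] (f : A →ₐ[R] A') (hf : Function.Surjective f) :
    Function.Surjective (fixMap (R := R) n G f) := by
  obtain ⟨σ, hσ⟩ := Module.projective_lifting_property f.toLinearMap LinearMap.id hf
  let τ : TPow R A' n →ₗ[R] TPow R A n := PiTensorProduct.map fun _ => σ
  have hτ : ∀ x, tpowMap n f (τ x) = x := fun x => by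
    have h := PiTensorProduct.map_comp (R := R) (fun _ : Fin n => f.toLinearMap) fun _ => σ
    rw [hσ] at h
    exact (LinearMap.congr_fun h x).symm.trans
      (LinearMap.congr_fun (PiTensorProduct.map_id (R := R)) x)
  have hequiv : ∀ (g : Equiv.Perm (Fin n)) (x : TPow R A' n),
      permAction R A n g (τ x) = τ (permAction R A' n g x) := fun g x => by
    have h : (permHom R A n g).toLinearMap ∘ₗ τ = τ ∘ₗ (permHom R A' n g).toLinearMap := by
      ext y
      simp [permHom_tprod, τ]
    exact LinearMap.congr_fun h x
  intro y
  refine ⟨⟨τ y.1, fun g => ?_⟩, Subtype.ext (hτ y.1)⟩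
  exact (hequiv g y.1).trans (congrArg τ (y.2 g))

/-- The homomorphism `A^{⊗n} → T` given by `n` homomorphisms `A → T`. -/
noncomputable def tpowLift {A : Type v} {T : Type w} [CommRing A] [CommRing T] [Algebra R A]
    [Algebra R T] (p : Fin n → A →ₐ[R] T) : TPow R A n →ₐ[R] T :=
  PiTensorProduct.liftAlgHom
    ((MultilinearMap.mkPiAlgebra R (Fin n) T).compLinearMap fun i => (p i).toLinearMap)
    (by simp) (by simp [Finset.prod_mul_distrib])

lemma tpowLift_conjugate {A : Type v} {T : Type w} [CommRing A] [CommRing T] [Algebra R A]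
    [Algebra R T] (p : Fin n → A →ₐ[R] T) (a : A) (i : Fin n) :
    tpowLift p (conjugate R n a i) = p i a := by
  have h : tpowLift p (conjugate R n a i) = ∏ j, p j (Pi.mulSingle (M := fun _ => A) i a j) :=
    PiTensorProduct.lift.tprod (R := R) (s := fun _ : Fin n => A) _
  rw [h, Finset.prod_eq_single i]
  · simp
  · intro j _ hj
    simp [Pi.mulSingle_eq_of_ne hj]
  · simp

lemma algHom_conjugate_aeval {A : Type v} {T : Type w} [CommRing A] [CommRing T] [Algebra R A]
    [Algebra R T] (j : TPow R A n →ₐ[R] T) (a : A) (g : R[X]) (i : Fin n) :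
    j (conjugate R n (Polynomial.aeval a g) i) = Polynomial.aeval (j (conjugate R n a i)) g := by
  simp only [conjugate_eq_singleAlgHom]
  exact (Polynomial.aeval_algHom_apply
    (j.comp (PiTensorProduct.singleAlgHom (R := R) (A := fun _ : Fin n => A) i)) a g).symm

end TensorPower

/-! ### Elementary symmetric functions and characteristic polynomials -/

section Charpoly

open Polynomial

variable {R : Type u} [CommRing R] {n : ℕ}

lemma coeff_prod_X_sub_C {T : Type w} [CommRing T] (c : Fin n → T) {k : ℕ} (hk : k ≤ n) :
    (∏ i, (X - C (c i))).coeff (n - k) =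
      (-1) ^ k * ∑ t ∈ Finset.powersetCard k Finset.univ, ∏ i ∈ t, c i := by
  have hcard : Multiset.card ((Finset.univ : Finset (Fin n)).val.map c) = n := by simp
  have h := Multiset.prod_X_sub_C_coeff ((Finset.univ : Finset (Fin n)).val.map c)
    (k := n - k) (by rw [hcard]; exact Nat.sub_le n k)
  rw [hcard, Nat.sub_sub_self hk, Finset.esymm_map_val, Multiset.map_map] at h
  exact h

variable {A : Type v} [CommRing A] [Algebra R A]

lemma map_elemSymm {B : Type v} [CommRing B] [Algebra R B] {T : Type w} [CommRing T] [Algebra R T]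
    (j : TPow R B n →ₐ[R] T) (k : ℕ) (b : B) :
    j (elemSymm R n k b) =
      ∑ t ∈ Finset.powersetCard k Finset.univ, ∏ i ∈ t, j (conjugate R n b i) := by
  simp [elemSymm]

lemma IsMonogenic.aeval_surjective {a : A} (ha : IsMonogenic R n a) :
    Function.Surjective (aeval (R := R) a) := by
  obtain ⟨f, -, -, ι, rfl⟩ := ha
  intro b
  obtain ⟨g, hg⟩ := AdjoinRoot.mk_surjective (ι.symm b)
  refine ⟨g, ?_⟩
  rw [aeval_algHom_apply, AdjoinRoot.aeval_eq, hg, AlgEquiv.apply_symm_apply]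

lemma IsMonogenic.finrank_eq [Nontrivial R] {a : A} (ha : IsMonogenic R n a) :
    Module.finrank R A = n := by
  obtain ⟨f, hdeg, hcoeff, ι, -⟩ := ha
  have hf : f.Monic := monic_of_natDegree_le_of_coeff_eq_one n hdeg hcoeff
  rw [← ι.toLinearEquiv.finrank_eq, (AdjoinRoot.powerBasis' hf).finrank,
    AdjoinRoot.powerBasis'_dim]
  exact le_antisymm hdeg (le_natDegree_of_ne_zero (by simp [hcoeff]))

variable [Module.Free R A] [Module.Finite R A]

/-- The polynomials killing the generator are the multiples of its characteristic polynomial; hence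
a root of the latter in any `R`-algebra is the image of the generator under a homomorphism from
`A`. -/
lemma IsMonogenic.exists_algHom {a : A} (ha : IsMonogenic R n a) {T : Type w} [CommRing T]
    [Algebra R T] (c : T) (hc : aeval c (Algebra.lmul R A a).charpoly = 0) :
    ∃ p : A →ₐ[R] T, p a = c := by
  nontriviality T
  have : Nontrivial R := (algebraMap R T).domain_nontrivial
  have hrank := ha.finrank_eq
  obtain ⟨f, hdeg, hcoeff, ι, rfl⟩ := ha
  have hf : f.Monic := monic_of_natDegree_le_of_coeff_eq_one n hdeg hcoeff
  have hdvd : f ∣ (Algebra.lmul R A (ι (AdjoinRoot.root f))).charpoly := by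
    rw [← AdjoinRoot.mk_eq_zero, ← AdjoinRoot.aeval_eq]
    apply ι.injective
    rw [map_zero, ← aeval_algHom_apply]
    exact Algebra.aeval_self_charpoly_lmul _
  have heq := eq_of_monic_of_dvd_of_natDegree_le hf (LinearMap.charpoly_monic _) hdvd (by
    rw [LinearMap.charpoly_natDegree, hrank]
    exact le_natDegree_of_ne_zero (by simp [hcoeff]))
  rw [heq] at hc
  refine ⟨(AdjoinRoot.liftAlgHom f (Algebra.ofId R T) c hc).comp
    (ι.symm : A →ₐ[R] AdjoinRoot f), ?_⟩
  rw [AlgHom.comp_apply, AlgEquiv.coe_toAlgHom, AlgEquiv.symm_apply_apply]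
  exact AdjoinRoot.lift_root hc

/-- If the characteristic polynomial of `a` becomes `∏ (X - cᵢ)` over `T`, then that of `g(a)`
becomes `∏ (X - g(cᵢ))`. -/
lemma charpoly_lmul_aeval_map {T : Type w} [CommRing T] [Algebra R T] (a : A) (c : Fin n → T)
    (hc : (Algebra.lmul R A a).charpoly.map (algebraMap R T) = ∏ i, (X - C (c i))) (g : R[X]) :
    (Algebra.lmul R A (aeval a g)).charpoly.map (algebraMap R T) =
      ∏ i, (X - C (aeval (c i) g)) := by
  let b := Module.Free.chooseBasis R A
  have hb : ∀ x : A, (Algebra.lmul R A x).charpoly = (Algebra.leftMulMatrix b x).charpoly :=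
    fun x => (LinearMap.charpoly_toMatrix (Algebra.lmul R A x) b).symm
  rw [hb, ← Matrix.charpoly_map] at hc
  rw [hb, ← Matrix.charpoly_map, ← aeval_algHom_apply]
  have key := charpoly_aeval_eq_prod _ c hc (g.map (algebraMap R T))
  simp only [eval_map_algebraMap, aeval_map_algebraMap] at key
  rw [← key]
  congr 1
  exact (aeval_algHom_apply ((Algebra.ofId R T).mapMatrix) (Algebra.leftMulMatrix b a) g).symm

end Charpoly

/-! ### Closure data of a monogenic algebra -/

section ClosureDatum

open Polynomial

variable {R : Type u} [CommRing R] {A : Type v} [CommRing A] [Algebra R A] [Module.Free R A]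
  [Module.Finite R A] {n : ℕ} {a : A} {G : Subgroup (Equiv.Perm (Fin n))}

/-- If `ψ` extends to a homomorphism `j` to an `R`-algebra `T`, then over `T` the characteristic
polynomial of `a` splits, with the images of the `n` conjugates of `X` as its roots. -/
lemma IsMonogenic.charpoly_map_eq_prod [Nontrivial R] (ha : IsMonogenic R n a)
    (ψ : fixPower R R[X] n G →ₐ[R] R)
    (hψ : ∀ k, 1 ≤ k → k ≤ n → ψ (e R n G k (X : R[X])) = s R n k a)
    {T : Type w} [CommRing T] [Algebra R T] (j : TPow R R[X] n →ₐ[R] T)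
    (hj : ∀ x : fixPower R R[X] n G, j x = algebraMap R T (ψ x)) :
    (Algebra.lmul R A a).charpoly.map (algebraMap R T) =
      ∏ i, (X - C (j (conjugate R n X i))) := by
  have hdeg : (Algebra.lmul R A a).charpoly.natDegree = n := by
    rw [LinearMap.charpoly_natDegree, ha.finrank_eq]
  have hcoeff : ∀ k ≤ n, algebraMap R T ((Algebra.lmul R A a).charpoly.coeff (n - k)) =
      (∏ i, (X - C (j (conjugate R n X i)))).coeff (n - k) := by
    intro k hk
    rw [coeff_prod_X_sub_C _ hk, ← map_elemSymm]
    rcases Nat.eq_zero_or_pos k with rfl | hk0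
    · have : (Algebra.lmul R A a).charpoly.coeff n = 1 := by
        rw [← hdeg]
        exact (LinearMap.charpoly_monic (Algebra.lmul R A a)).coeff_natDegree
      rw [Nat.sub_zero, this]
      simp [elemSymm]
    · have h := hj (e R n G k X)
      rw [hψ k hk0 hk, s, map_mul, map_pow, map_neg, map_one] at h
      change j (elemSymm R n k X) = _ at h
      rw [h, ← mul_assoc, ← mul_pow]
      simp
  ext m
  rw [coeff_map]
  rcases le_or_gt m n with hm | hm
  · simpa [Nat.sub_sub_self hm] using hcoeff (n - m) (Nat.sub_le n m)
  · rw [coeff_eq_zero_of_natDegree_lt (by omega), map_zero, coeff_eq_zero_of_natDegree_lt]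
    refine lt_of_le_of_lt ((natDegree_prod_le _ _).trans
      (Finset.sum_le_card_nsmul _ _ 1 fun i _ => natDegree_X_sub_C_le _)) ?_
    simpa using hm

/-- Every homomorphism with the prescribed values at the `e_k(X)` comes from a closure datum. Extend
`ψ` to `j : R[X]^{⊗n} → T` with `T` faithful over `R`. The elements `j(X⁽ⁱ⁾)` are roots of the
characteristic polynomial of `a`, so `j` factors through `A^{⊗n}` and `ψ` through `(A^{⊗n})^G`. -/
theorem IsBenign.exists_isClosureDatum (h : IsBenign R G) (ha : IsMonogenic R n a)
    (ψ : fixPower R R[X] n G →ₐ[R] R)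
    (hψ : ∀ k, 1 ≤ k → k ≤ n → ψ (e R n G k (X : R[X])) = s R n k a) :
    ∃ φ : fixPower R A n G →ₐ[R] R, IsClosureDatum R n G φ ∧
      φ.comp (fixMap n G (aeval (R := R) a)) = ψ := by
  have hsurj := fixMap_surjective (n := n) (G := G) (aeval (R := R) a) ha.aeval_surjective
  obtain ⟨T, _, _, j, hinj, hj⟩ := h.exists_extension _ _ ψ
  have hsplit := fun _ : Nontrivial R => ha.charpoly_map_eq_prod ψ hψ j hj
  have hker : RingHom.ker (fixMap n G (aeval (R := R) a)).toRingHom ≤ RingHom.ker ψ.toRingHom := by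
    intro x hx
    change ψ x = 0
    nontriviality R
    have hroot : ∀ i, aeval (j (conjugate R n X i)) (Algebra.lmul R A a).charpoly = 0 := fun i => by
      rw [← eval_map_algebraMap, hsplit inferInstance, eval_prod]
      exact Finset.prod_eq_zero (Finset.mem_univ i) (by simp)
    choose p hp using fun i => ha.exists_algHom _ (hroot i)
    have hfac : j = (tpowLift p).comp (tpowMap n (aeval (R := R) a)) := by
      refine PiTensorProduct.algHom_ext fun i => Polynomial.algHom_ext ?_
      change j (conjugate R n X i) = tpowLift p (tpowMap n (aeval a) (conjugate R n X i))
      rw [tpowMap_conjugate, tpowLift_conjugate, aeval_X, hp]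
    have hx : tpowMap n (aeval (R := R) a) x = 0 := congrArg Subtype.val hx
    apply hinj
    rw [← hj, hfac, AlgHom.comp_apply, hx, map_zero, map_zero]
  refine ⟨AlgHom.liftOfSurjective _ hsurj ψ hker, ?_, AlgHom.liftOfSurjective_comp _ _ _ _⟩
  intro b k hk1 hkn
  nontriviality R
  obtain ⟨g, rfl⟩ := ha.aeval_surjective b
  rw [← fixMap_e, AlgHom.liftOfSurjective_apply]
  apply hinj
  rw [← hj, s, map_mul, map_pow, map_neg, map_one, ← coeff_map,
    charpoly_lmul_aeval_map a _ (hsplit inferInstance) g, coeff_prod_X_sub_C _ hkn, ← mul_assoc,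
    ← mul_pow, neg_one_mul, neg_neg, one_pow, one_mul]
  refine (map_elemSymm j k g).trans (Finset.sum_congr rfl fun t _ => Finset.prod_congr rfl
    fun i _ => ?_)
  simpa using algHom_conjugate_aeval j X g i

end ClosureDatum

end ClosureData

theorem mainTheorem7 {R : Type u} {A : Type v} [CommRing R] [CommRing A] [Algebra R A]
    [Module.Free R A] [Module.Finite R A] (n : ℕ) (a : A)
    (ha : ClosureData.IsMonogenic R n a) (G : Subgroup (Equiv.Perm (Fin n))) :
    -- the two sufficient conditions for `(R, G)` to be benign
    (IsReduced R → ClosureData.IsBenign R G) ∧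
    ((Nat.card G : R) ∈ nonZeroDivisors R → ClosureData.IsBenign R G) ∧
    -- composing a closure datum with the projection sends `e_k(x)` to `s_k(a)`
    (∀ φ : ClosureData.fixPower R A n G →ₐ[R] R, ClosureData.IsClosureDatum R n G φ →
      ∀ k : ℕ, 1 ≤ k → k ≤ n →
        (φ.comp (ClosureData.fixMap n G (Polynomial.aeval (R := R) a)))
          (ClosureData.e R n G k (Polynomial.X : R[X])) = ClosureData.s R n k a) ∧
    -- and this is a bijection if `(R, G)` is benign
    (ClosureData.IsBenign R G →
      Set.BijOn
        (fun φ : ClosureData.fixPower R A n G →ₐ[R] R =>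
          φ.comp (ClosureData.fixMap n G (Polynomial.aeval (R := R) a)))
        {φ | ClosureData.IsClosureDatum R n G φ}
        {ψ : ClosureData.fixPower R R[X] n G →ₐ[R] R | ∀ k : ℕ, 1 ≤ k → k ≤ n →
          ψ (ClosureData.e R n G k (Polynomial.X : R[X])) = ClosureData.s R n k a}) := by
  have hcomp : ∀ φ : ClosureData.fixPower R A n G →ₐ[R] R, ClosureData.IsClosureDatum R n G φ →
      ∀ k : ℕ, 1 ≤ k → k ≤ n →
        (φ.comp (ClosureData.fixMap n G (Polynomial.aeval (R := R) a)))
          (ClosureData.e R n G k (Polynomial.X : R[X])) = ClosureData.s R n k a := by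
    intro φ hφ k hk1 hkn
    rw [AlgHom.comp_apply, ClosureData.fixMap_e, Polynomial.aeval_X, hφ a k hk1 hkn]
  refine ⟨ClosureData.isBenign_of_isReduced, ClosureData.isBenign_of_card_mem_nonZeroDivisors,
    hcomp, fun h => ⟨hcomp, fun φ _ φ' _ heq => ?_, fun ψ hψ => h.exists_isClosureDatum ha ψ hψ⟩⟩
  exact (AlgHom.cancel_right (ClosureData.fixMap_surjective _ ha.aeval_surjective)).1 heq
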